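/- \textbf{Proposition.} There is an absolute constant $C$ such that the following holds. \emph{Setting.} Let $V$ be a finite-dimensional complex Hilbert space with sites labelled by $[n]=\{1,\dots,n\}$ and, for each site $i$, a subalgebra $\mathcal A_i$ of the operators on $V$ (for $n$ qubits: the operators acting on the $i$-th tensor factor; for Majorana fermions: the algebra generated by $\chi_i$). The support of an operator is the smallest set $Z\subset[n]$ (the intersection of all sets $Z$) such that the operator lies in the algebra generated by the $\mathcal A_i$, $i\in Z$. Let $\Gamma$ and $A$ be finite sets, let $H_\gamma$ ($\gamma\in\Gamma$) be Hermitian operators with $H_\gamma^2=h_\gamma^2 I$, $h_\gamma\ge 0$, and let $A^a$ ($a\in A$) be Hermitian operators with $(A^a)^2=I$. Write $S(\gamma)$ for the support of $H_\gamma$. Assume: (1) $[A^a,H_\gamma]=2b_{a\gamma}A^aH_\gamma$ and $[H_\gamma,H_{\gamma'}]=2b_{\gamma\gamma'}H_\gamma H_{\gamma'}$ with $b_{a\gamma},b_{\gamma\gamma'}\in\{0,1\}$, where $b_{a\gamma}=0$ whenever the supports of $A^a$ and $H_\gamma$ are disjoint, and $b_{\gamma\gamma'}=0$ whenever $S(\gamma)\cap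 S(\gamma')=\varnothing$; (2) each $A^a$ is supported on exactly one site, $|S(\gamma)|=k$ for all $\gamma$, and for some real numbers $a_{\mathrm{ac}}\le a_{\mathrm{loc}}$ we have $\sum_{a}b_{a\gamma}=a_{\mathrm{ac}}k$ for every $\gamma$, and for every $Z\subset[n]$ exactly $a_{\mathrm{loc}}|Z|$ of the jumps $A^a$ have support meeting $Z$. Put $\|H\|_{\mathrm{loc}}=\max_{i}\bigl(\sum_{\gamma:\,i\in S(\gamma)}h_\gamma^2\bigr)^{1/2}$ and $\|H\|_{\mathrm{glo}}=\bigl(\sum_\gamma h_\gamma^2\bigr)^{1/2}$. Let $y\in\mathbb R$. For signs $s\in\{\pm1\}^\Gamma$ let $H=\sum_\gamma s_\gamma H_\gamma$, $K^a=A^a+y[A^a,H]$ and $$\mathcal L^\dagger(O)=\sum_{a\in A}\Bigl(K^{a\dagger}OK^a-\tfrac12\{K^{a\dagger}K^a,O\}\Bigr).$$ For $U\subset\Gamma$ let the operator $O_U$ be the coefficient of $\prod_{\alpha\in U}s_\alpha$ in the expansion of $\mathcal L^\dagger(\mathcal L^\dagger(H))$ as a polynomial in the signs $s_\gamma$, after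 cancelling $s_\gamma^2=1$ (each $O_U$ is independent of $s$). \emph{Conclusion.} If $y^2\|H\|_{\mathrm{loc}}^2\,a_{\mathrm{loc}}\,k<1/8$, then $$\mathcal L^\dagger(\mathcal L^\dagger(H))=\sum_{U\subset\Gamma,\ |U|\le5}\Bigl(\prod_{\alpha\in U}s_\alpha\Bigr)O_U\quad\text{for all } s\in\{\pm1\}^\Gamma,$$ and $$\sum_{U\subset\Gamma,\ |U|\le5}\Bigl(\prod_{\alpha\in U}h_\alpha\Bigr)|y|^{|U|}\,\|O_U\|\le C\,|y|\,a_{\mathrm{loc}}^2k^2\,\|H\|_{\mathrm{glo}}^2,$$ where $\|\cdot\|$ is the operator norm. -/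

import Mathlib

open scoped BigOperators

namespace LocalHamiltonian

section Support

variable {V : Type} [NormedAddCommGroup V] [InnerProductSpace ℂ V] {n : ℕ}

/-- The operators that live on a set `Z` of sites: the algebra generated by the site algebras
`𝒜 i`, `i ∈ Z`. For `n` qubits `𝒜 i` is the algebra of operators `I ⊗ ⋯ ⊗ M ⊗ ⋯ ⊗ I` with
`M` in position `i`; for Majorana fermions `𝒜 i` is the algebra generated by `χ i`. -/
def regionAlgebra (𝒜 : Fin n → Subalgebra ℂ (V →L[ℂ] V)) (Z : Set (Fin n)) :
    Subalgebra ℂ (V →L[ℂ] V) :=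
  ⨆ i ∈ Z, 𝒜 i

/-- The support of an operator, i.e. the set of sites on which it acts nontrivially: the smallest
set of sites on which the operator lives (the intersection of all such sets). -/
def support (𝒜 : Fin n → Subalgebra ℂ (V →L[ℂ] V)) (X : V →L[ℂ] V) : Set (Fin n) :=
  {i | ∀ Z : Set (Fin n), X ∈ regionAlgebra 𝒜 Z → i ∈ Z}

/-- The labels of the jump operators whose support meets `Z`. -/
def jumpsMeeting {J : Type} (𝒜 : Fin n → Subalgebra ℂ (V →L[ℂ] V)) (A : J → (V →L[ℂ] V))
    (Z : Finset (Fin n)) : Set J :=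
  {a | (support 𝒜 (A a) ∩ (Z : Set (Fin n))).Nonempty}

end Support

section Conditions

variable {V : Type} [NormedAddCommGroup V] [InnerProductSpace ℂ V] [CompleteSpace V]
variable {n : ℕ} {Γ J : Type}

/-- The Hamiltonian terms are Hermitian and square to `h γ ^ 2` times the identity, where
`h γ ≥ 0` is the strength of the term. -/
structure SquareCondition (H : Γ → (V →L[ℂ] V)) (h : Γ → ℝ) : Prop where
  isSelfAdjoint : ∀ γ, IsSelfAdjoint (H γ)
  nonneg : ∀ γ, 0 ≤ h γ
  sq_eq : ∀ γ, H γ * H γ = ((h γ ^ 2 : ℝ) : ℂ) • (1 : V →L[ℂ] V)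

/-- The jumps are Hermitian and square to the identity; jumps and Hamiltonian terms, and
Hamiltonian terms among themselves, commute (`b = 0`) or anticommute (`b = 1`), and they commute
when their supports are disjoint. -/
structure CommutationCondition (𝒜 : Fin n → Subalgebra ℂ (V →L[ℂ] V))
    (H : Γ → (V →L[ℂ] V)) (A : J → (V →L[ℂ] V)) (b : J → Γ → ℕ) (b' : Γ → Γ → ℕ) : Prop where
  jump_isSelfAdjoint : ∀ a, IsSelfAdjoint (A a)
  jump_sq : ∀ a, A a * A a = 1
  jump_mem : ∀ a γ, b a γ = 0 ∨ b a γ = 1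
  jump_comm : ∀ a γ, ⁅A a, H γ⁆ = (b a γ : ℂ) • ((2 : ℂ) • (A a * H γ))
  jump_disjoint : ∀ a γ, Disjoint (support 𝒜 (A a)) (support 𝒜 (H γ)) → b a γ = 0
  term_mem : ∀ γ γ', b' γ γ' = 0 ∨ b' γ γ' = 1
  term_comm : ∀ γ γ', ⁅H γ, H γ'⁆ = (b' γ γ' : ℂ) • ((2 : ℂ) • (H γ * H γ'))
  term_disjoint : ∀ γ γ', Disjoint (support 𝒜 (H γ)) (support 𝒜 (H γ')) → b' γ γ' = 0

/-- Every jump is supported on one site, every Hamiltonian term on `k` sites, every Hamiltonian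
term anticommutes with `aac * k` jumps, and `aloc * |Z|` jumps act on each set `Z` of sites. -/
structure LocalityCondition [Fintype J] (𝒜 : Fin n → Subalgebra ℂ (V →L[ℂ] V))
    (H : Γ → (V →L[ℂ] V)) (A : J → (V →L[ℂ] V)) (b : J → Γ → ℕ)
    (k : ℕ) (aloc aac : ℝ) : Prop where
  jump_single : ∀ a, ∃ i, support 𝒜 (A a) = {i}
  term_card : ∀ γ, (support 𝒜 (H γ)).ncard = k
  aac_le_aloc : aac ≤ aloc
  anticomm_count : ∀ γ, ((∑ a, b a γ : ℕ) : ℝ) = aac * k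
  jump_count : ∀ Z : Finset (Fin n), ((jumpsMeeting 𝒜 A Z).ncard : ℝ) = aloc * Z.card

end Conditions

section Energies

variable {V : Type} [NormedAddCommGroup V] [InnerProductSpace ℂ V]
variable {n : ℕ} {Γ : Type} [Fintype Γ]

open Classical in
/-- The local energy `max_i √(∑_{γ : i ∈ S(γ)} h_γ²)`. -/
noncomputable def localEnergy (𝒜 : Fin n → Subalgebra ℂ (V →L[ℂ] V))
    (H : Γ → (V →L[ℂ] V)) (h : Γ → ℝ) : ℝ :=
  ⨆ i : Fin n, √(∑ γ with i ∈ support 𝒜 (H γ), h γ ^ 2)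

/-- The global energy `√(∑_γ h_γ²)`. -/
noncomputable def globalEnergy (h : Γ → ℝ) : ℝ :=
  √(∑ γ, h γ ^ 2)

end Energies

section Lindbladian

variable {V : Type} [NormedAddCommGroup V] [InnerProductSpace ℂ V] [CompleteSpace V]
variable {Γ J : Type} [Fintype Γ] [Fintype J]

/-- The Hamiltonian `∑_γ s_γ H_γ` for given signs `s_γ = ±1`. -/
def hamiltonian (H : Γ → (V →L[ℂ] V)) (s : Γ → ℤˣ) : V →L[ℂ] V :=
  ∑ γ, s γ • H γ

/-- The polarized dissipator `P† X Q - ½ {P† Q, X}`. -/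
noncomputable def dissipator (P Q X : V →L[ℂ] V) : V →L[ℂ] V :=
  star P * X * Q - (1 / 2 : ℂ) • (star P * Q * X + X * (star P * Q))

/-- The Lindblad operator `K^a = A^a + y [A^a, H]`, where `H` is the signed Hamiltonian. -/
def lindbladOperator (H : Γ → (V →L[ℂ] V)) (A : J → (V →L[ℂ] V)) (y : ℝ)
    (s : Γ → ℤˣ) (a : J) : V →L[ℂ] V :=
  A a + (y : ℂ) • ⁅A a, hamiltonian H s⁆

/-- The Lindbladian in the Heisenberg picture,
`L†(X) = ∑_a (K^a† X K^a - ½ {K^a† K^a, X})`. -/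
noncomputable def lindbladian (H : Γ → (V →L[ℂ] V)) (A : J → (V →L[ℂ] V)) (y : ℝ)
    (s : Γ → ℤˣ) (X : V →L[ℂ] V) : V →L[ℂ] V :=
  ∑ a, dissipator (lindbladOperator H A y s a) (lindbladOperator H A y s a) X

/-- The coefficients of `K^a` as a polynomial of degree one in the signs: `A^a` is the constant
term (label `none`) and `y [A^a, H_γ]` is the coefficient of `s_γ` (label `some γ`). -/
def lindbladOperatorCoeff (H : Γ → (V →L[ℂ] V)) (A : J → (V →L[ℂ] V)) (y : ℝ) (a : J) :
    Option Γ → (V →L[ℂ] V)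
  | none => A a
  | some γ => (y : ℂ) • ⁅A a, H γ⁆

/-- The coefficient of the monomial `s_p s_q` of the Lindbladian, which is a polynomial of degree
two in the signs (with `s_none = 1`). -/
noncomputable def lindbladianCoeff (H : Γ → (V →L[ℂ] V)) (A : J → (V →L[ℂ] V)) (y : ℝ)
    (p q : Option Γ) (X : V →L[ℂ] V) : V →L[ℂ] V :=
  ∑ a, dissipator (lindbladOperatorCoeff H A y a p) (lindbladOperatorCoeff H A y a q) X

/-- The signs that survive in the monomial `∏_{p ∈ l} s_p` (with `s_none = 1`) after cancelling
`s_α ^ 2 = 1`: those that occur an odd number of times. -/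
def survivingSigns [DecidableEq Γ] (l : List (Option Γ)) : Finset Γ :=
  {α | Odd (l.count (some α))}

/-- The coefficient `O_U` of `∏_{α ∈ U} s_α` in `L†(L†(H))`, where `L†(L†(H))` is expanded as a
polynomial in the signs and squares of signs are cancelled: the sum of all terms of the expansion
in which exactly the signs with label in `U` survive. -/
noncomputable def expansionCoeff [DecidableEq Γ] (H : Γ → (V →L[ℂ] V)) (A : J → (V →L[ℂ] V))
    (y : ℝ) (U : Finset Γ) : V →L[ℂ] V :=
  ∑ γ₀ : Γ, ∑ p₁ : Option Γ, ∑ p₂ : Option Γ, ∑ p₃ : Option Γ, ∑ p₄ : Option Γ,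
    if survivingSigns [some γ₀, p₁, p₂, p₃, p₄] = U then
      lindbladianCoeff H A y p₄ p₃ (lindbladianCoeff H A y p₂ p₁ (H γ₀))
    else 0

end Lindbladian

end LocalHamiltonian

/-!
All operators that occur in `L†(L†(H))` are multiples of products of Hamiltonian terms, and such a
product `X` commutes with every jump and every term up to a sign. Hence the dissipator of
`A * H_p` and `A * H_q` sends `X` to a multiple of `X * H_p * H_q`, and the scalar in front is at
most twice the number of factors of `X` that anticommute with `A`, plus the numbers of those that
anticommute with `H_p` and with `H_q`. In particular it vanishes unless something anticommutes.

Give every sign `s_γ` the weight `g γ = |y| h γ`. Since `‖H_γ‖ ≤ h γ`, multiplying by `s_γ H_γ`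
changes weight times norm by a factor `g γ ^ 2` if `s_γ` is new, and by at most `1` if it cancels
a sign that is already present. Locality bounds the total of `g γ ^ 2` over the terms `γ` that
anticommute with a given jump or term, while cancellation is possible for the few signs of the
monomial only. So one application of the Lindbladian multiplies the total weighted norm of a
product of boundedly many terms by at most a constant times the number `aloc * k` of jumps that
can anticommute with one term. Starting from `∑ γ, g γ * ‖H γ‖ ≤ |y| * ∑ γ, h γ ^ 2`, two
applications give the bound.
-/

namespace LocalHamiltonian

section Signs

open scoped symmDiff

lemma prod_symmDiff_of_mul_self_eq_one {ι M : Type*} [DecidableEq ι] [CommMonoid M] {f : ι → M}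
    (hf : ∀ i, f i * f i = 1) (u v : Finset ι) :
    ∏ i ∈ u ∆ v, f i = (∏ i ∈ u, f i) * ∏ i ∈ v, f i := by
  have h_inter : (∏ i ∈ u ∩ v, f i) * ∏ i ∈ u ∩ v, f i = 1 := by
    simp only [← Finset.prod_mul_distrib, hf, Finset.prod_const_one]
  have h_symmDiff : u ∆ v = (u ∪ v) \ (u ∩ v) := symmDiff_eq_sup_sdiff_inf u v
  rw [h_symmDiff, ← Finset.prod_union_inter,
    ← Finset.prod_sdiff (Finset.inter_subset_union : u ∩ v ⊆ u ∪ v), mul_assoc, h_inter, mul_one]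

variable {Γ : Type} [Fintype Γ] [DecidableEq Γ]

lemma survivingSigns_nil : survivingSigns ([] : List (Option Γ)) = ∅ := by
  simp [survivingSigns]

lemma survivingSigns_cons (p : Option Γ) (l : List (Option Γ)) :
    survivingSigns (p :: l) = p.toFinset ∆ survivingSigns l := by
  ext α
  by_cases hp : p = some α <;>
    simp [survivingSigns, Finset.mem_symmDiff, List.count_cons, hp, Nat.odd_add_one]

lemma survivingSigns_perm {l l' : List (Option Γ)} (hl : l.Perm l') :
    survivingSigns l = survivingSigns l' := by
  simp only [survivingSigns, hl.count_eq]

lemma card_survivingSigns_le_length (l : List (Option Γ)) :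
    (survivingSigns l).card ≤ l.length := by
  have h_sub : survivingSigns l ⊆ l.reduceOption.toFinset := fun α hα => by
    have hα : Odd (l.count (some α)) := by simpa [survivingSigns] using hα
    simpa [List.reduceOption_mem_iff] using List.count_pos_iff.1 hα.pos
  exact (Finset.card_le_card h_sub).trans
    ((List.toFinset_card_le _).trans (List.reduceOption_length_le l))

lemma prod_survivingSigns (s : Γ → ℤˣ) (l : List (Option Γ)) :
    ∏ α ∈ survivingSigns l, s α = (l.map fun p => p.elim 1 s).prod := by
  induction l with
  | nil => simp [survivingSigns_nil]
  | cons p l ih =>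
    have hp : ∏ α ∈ p.toFinset, s α = p.elim 1 s := by cases p <;> simp
    rw [survivingSigns_cons, prod_symmDiff_of_mul_self_eq_one fun α => Int.units_mul_self (s α),
      hp, ih, List.map_cons, List.prod_cons]

end Signs

section Expansion

variable {V : Type} [NormedAddCommGroup V] [InnerProductSpace ℂ V] [CompleteSpace V]

lemma dissipator_sum_sum {ι κ : Type*} (S : Finset ι) (T : Finset κ) (P : ι → (V →L[ℂ] V))
    (Q : κ → (V →L[ℂ] V)) (X : V →L[ℂ] V) :
    dissipator (∑ i ∈ S, P i) (∑ j ∈ T, Q j) X = ∑ i ∈ S, ∑ j ∈ T, dissipator (P i) (Q j) X := by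
  simp only [dissipator, star_sum, Finset.sum_mul, Finset.mul_sum, Finset.smul_sum,
    Finset.sum_sub_distrib, Finset.sum_add_distrib, smul_add]
  simp only [Finset.sum_comm (s := T)]

lemma dissipator_sum_right {ι : Type*} (S : Finset ι) (P Q : V →L[ℂ] V)
    (X : ι → (V →L[ℂ] V)) :
    dissipator P Q (∑ i ∈ S, X i) = ∑ i ∈ S, dissipator P Q (X i) := by
  simp only [dissipator, Finset.sum_mul, Finset.mul_sum, Finset.smul_sum,
    Finset.sum_sub_distrib, Finset.sum_add_distrib, smul_add]

lemma dissipator_smul_smul_smul (c d e : ℂ) (P Q X : V →L[ℂ] V) :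
    dissipator (c • P) (d • Q) (e • X) = (star c * d * e) • dissipator P Q X := by
  simp only [dissipator, star_smul, smul_mul_assoc, mul_smul_comm, smul_smul, smul_sub, smul_add]
  module

lemma dissipator_units_smul (u v w : ℤˣ) (P Q X : V →L[ℂ] V) :
    dissipator (u • P) (v • Q) (w • X) = (u * v * w) • dissipator P Q X := by
  have h_smul (t : ℤˣ) (Y : V →L[ℂ] V) : t • Y = ((t : ℤ) : ℂ) • Y := by
    rw [Units.smul_def, Int.cast_smul_eq_zsmul]
  simp only [h_smul, dissipator_smul_smul_smul, star_intCast, Units.val_mul, Int.cast_mul]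

variable {Γ J : Type} [Fintype Γ] (H : Γ → (V →L[ℂ] V)) (A : J → (V →L[ℂ] V)) (y : ℝ)
  (s : Γ → ℤˣ)

omit [CompleteSpace V] in
lemma lindbladOperator_eq_sum (a : J) :
    lindbladOperator H A y s a = ∑ p : Option Γ, p.elim 1 s • lindbladOperatorCoeff H A y a p := by
  simp only [lindbladOperator, hamiltonian, Fintype.sum_option, Option.elim_none, Option.elim_some,
    lindbladOperatorCoeff, one_smul, Ring.lie_def, Finset.mul_sum, Finset.sum_mul,
    ← Finset.sum_sub_distrib, Finset.smul_sum]
  congr! 2 with γ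
  rw [Units.smul_def, Units.smul_def, mul_smul_comm, smul_mul_assoc, ← smul_sub, smul_comm]

variable [Fintype J]

lemma lindbladian_units_smul_eq_sum (w : ℤˣ) (X : V →L[ℂ] V) :
    lindbladian H A y s (w • X) =
      ∑ q : Option Γ, ∑ p : Option Γ,
        (p.elim 1 s * q.elim 1 s * w) • lindbladianCoeff H A y p q X := by
  simp only [lindbladian, lindbladOperator_eq_sum, dissipator_sum_sum, dissipator_units_smul,
    lindbladianCoeff, Finset.smul_sum]
  rw [Finset.sum_comm]
  refine (Finset.sum_congr rfl fun p _ => Finset.sum_comm).trans ?_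
  rw [Finset.sum_comm]

lemma lindbladian_sum {ι : Type*} (S : Finset ι) (X : ι → (V →L[ℂ] V)) :
    lindbladian H A y s (∑ i ∈ S, X i) = ∑ i ∈ S, lindbladian H A y s (X i) := by
  simp only [lindbladian, dissipator_sum_right]
  exact Finset.sum_comm

/-- One term of the expansion of `L†(L†(H))`: the Hamiltonian term `γ₀`, followed by the labels
`p₁, p₂` of the inner and `p₃, p₄` of the outer Lindbladian coefficient. -/
abbrev ExpansionIndex (Γ : Type) : Type := Γ × Option Γ × Option Γ × Option Γ × Option Γ

/-- The labels of a term of the expansion of `L†(L†(H))`, the last one applied coming first. -/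
def ExpansionIndex.labels : ExpansionIndex Γ → List (Option Γ)
  | (γ₀, p₁, p₂, p₃, p₄) => [p₃, p₄, p₁, p₂, some γ₀]

/-- The operator in a term of the expansion of `L†(L†(H))`, without its signs. -/
noncomputable def expansionTerm : ExpansionIndex Γ → (V →L[ℂ] V)
  | (γ₀, p₁, p₂, p₃, p₄) => lindbladianCoeff H A y p₄ p₃ (lindbladianCoeff H A y p₂ p₁ (H γ₀))

lemma lindbladian_lindbladian_hamiltonian_eq_sum :
    lindbladian H A y s (lindbladian H A y s (hamiltonian H s)) =
      ∑ x : ExpansionIndex Γ,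
        (x.labels.map fun p => p.elim 1 s).prod • expansionTerm H A y x := by
  simp only [hamiltonian, lindbladian_sum, lindbladian_units_smul_eq_sum, Fintype.sum_prod_type,
    ExpansionIndex.labels, expansionTerm, List.map_cons, List.map_nil, List.prod_cons,
    List.prod_nil, Option.elim_some]
  congr! 6
  grind

variable [DecidableEq Γ]

lemma expansionCoeff_eq_sum (U : Finset Γ) :
    expansionCoeff H A y U =
      ∑ x : ExpansionIndex Γ with survivingSigns x.labels = U, expansionTerm H A y x := by
  have h_perm (γ₀ : Γ) (p₁ p₂ p₃ p₄ : Option Γ) :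
      survivingSigns [p₃, p₄, p₁, p₂, some γ₀] = survivingSigns [some γ₀, p₁, p₂, p₃, p₄] :=
    survivingSigns_perm (List.perm_append_comm (l₁ := [p₃, p₄]) (l₂ := [p₁, p₂, some γ₀]) |>.trans
      (List.perm_append_comm (l₁ := [p₁, p₂]) (l₂ := [some γ₀]) |>.append_right [p₃, p₄]))
  simp only [expansionCoeff, Finset.sum_filter, Fintype.sum_prod_type, ExpansionIndex.labels,
    expansionTerm, h_perm]

omit [Fintype J] in
lemma card_survivingSigns_labels_le (x : ExpansionIndex Γ) :
    (survivingSigns x.labels).card ≤ 5 :=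
  card_survivingSigns_le_length x.labels

theorem lindbladian_lindbladian_hamiltonian :
    lindbladian H A y s (lindbladian H A y s (hamiltonian H s)) =
      ∑ U : Finset Γ with U.card ≤ 5, (∏ α ∈ U, s α) • expansionCoeff H A y U := by
  have h_maps (x : ExpansionIndex Γ) (_ : x ∈ Finset.univ) :
      survivingSigns x.labels ∈ ({U | U.card ≤ 5} : Finset (Finset Γ)) := by
    simpa using card_survivingSigns_labels_le x
  rw [lindbladian_lindbladian_hamiltonian_eq_sum, ← Finset.sum_fiberwise_of_maps_to h_maps]
  refine Finset.sum_congr rfl fun U _ => ?_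
  rw [expansionCoeff_eq_sum, Finset.smul_sum]
  refine Finset.sum_congr rfl fun x hx => ?_
  rw [← prod_survivingSigns, (Finset.mem_filter.1 hx).2]

end Expansion

section LabelSum

variable {Γ : Type}

/-- The sum of `f` over the labels in `l`, with `f none = 0`. -/
def labelSum {R : Type*} [AddMonoid R] (f : Γ → R) (l : List (Option Γ)) : R :=
  (l.map fun p => p.elim 0 f).sum

lemma labelSum_nil {R : Type*} [AddMonoid R] (f : Γ → R) : labelSum f [] = 0 :=
  rfl

lemma labelSum_cons {R : Type*} [AddMonoid R] (f : Γ → R) (p : Option Γ) (l : List (Option Γ)) :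
    labelSum f (p :: l) = p.elim 0 f + labelSum f l :=
  rfl

lemma cast_labelSum (f : Γ → ℕ) (l : List (Option Γ)) :
    ((labelSum f l : ℕ) : ℝ) = labelSum (fun γ => (f γ : ℝ)) l := by
  induction l with
  | nil => simp [labelSum_nil]
  | cons p l ih => cases p <;> simp [labelSum_cons, ih]

lemma sum_mul_labelSum {ι R : Type*} [NonUnitalNonAssocSemiring R] (S : Finset ι) (c : ι → R)
    (f : ι → Γ → R) (l : List (Option Γ)) :
    ∑ i ∈ S, c i * labelSum (f i) l = labelSum (fun γ => ∑ i ∈ S, c i * f i γ) l := by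
  induction l with
  | nil => simp [labelSum_nil]
  | cons p l ih => cases p <;> simp [labelSum_cons, mul_add, Finset.sum_add_distrib, ih]

lemma sum_count_mul [Fintype Γ] [DecidableEq Γ] {R : Type*} [NonAssocSemiring R] (f : Γ → R)
    (l : List (Option Γ)) :
    ∑ γ, (l.count (some γ) : R) * f γ = labelSum f l := by
  induction l with
  | nil => simp [labelSum_nil]
  | cons p l ih =>
    cases p <;> simp [labelSum_cons, List.count_cons, add_mul, Finset.sum_add_distrib, ih, add_comm]

lemma labelSum_le_length_mul {f : Γ → ℝ} {c : ℝ} (hc : 0 ≤ c) (hf : ∀ γ, f γ ≤ c)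
    (l : List (Option Γ)) : labelSum f l ≤ l.length * c := by
  rw [← nsmul_eq_mul, ← List.length_map (f := fun p : Option Γ => p.elim 0 f)]
  refine List.sum_le_card_nsmul _ _ fun x hx => ?_
  obtain ⟨p, -, rfl⟩ := List.mem_map.1 hx
  cases p <;> simp [hf, hc]

end LabelSum

section LabelMass

variable {Γ : Type} [DecidableEq Γ] {g : Γ → ℝ}

/-- The factor that bounds the growth of the weight `∏_{α} g α` of the surviving signs, times
`g p`, when the label `p` is added to `l`: a new sign contributes `g γ ^ 2`, and a sign which is
cancelled contributes `1`. -/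
def labelMass (g : Γ → ℝ) (l : List (Option Γ)) (p : Option Γ) : ℝ :=
  p.elim 1 fun γ => g γ ^ 2 + l.count (some γ)

lemma labelMass_nonneg (g : Γ → ℝ) (l : List (Option Γ)) (p : Option Γ) :
    0 ≤ labelMass g l p := by
  cases p <;> simp only [labelMass, Option.elim_none, Option.elim_some] <;> positivity

lemma labelMass_cons_le (g : Γ → ℝ) (p q : Option Γ) (l : List (Option Γ)) :
    labelMass g (p :: l) q ≤ labelMass g l q + if p = q then 1 else 0 := by
  cases q with
  | none => simp only [labelMass, Option.elim_none]; split_ifs <;> norm_num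
  | some γ => simp [labelMass, List.count_cons, add_assoc]

variable [Fintype Γ]

lemma prod_survivingSigns_cons_mul_le (hg : ∀ γ, 0 ≤ g γ) (p : Option Γ) (l : List (Option Γ)) :
    (∏ α ∈ survivingSigns (p :: l), g α) * p.elim 1 g ≤
      (∏ α ∈ survivingSigns l, g α) * labelMass g l p := by
  have h_nonneg (u : Finset Γ) : 0 ≤ ∏ α ∈ u, g α := Finset.prod_nonneg fun α _ => hg α
  cases p with
  | none => simp [survivingSigns_cons, labelMass, ← Finset.bot_eq_empty]
  | some γ =>
    rw [survivingSigns_cons, Option.toFinset_some, Option.elim_some, labelMass, Option.elim_some]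
    by_cases hγ : γ ∈ survivingSigns l
    · have h_count : (1 : ℝ) ≤ l.count (some γ) := by
        have : Odd (l.count (some γ)) := by simpa [survivingSigns] using hγ
        exact_mod_cast this.pos
      rw [symmDiff_of_le (by simpa using hγ), Finset.sdiff_singleton_eq_erase,
        Finset.prod_erase_mul _ _ hγ]
      exact le_mul_of_one_le_right (h_nonneg _) (by nlinarith [sq_nonneg (g γ)])
    · rw [(Finset.disjoint_singleton_left.2 hγ).symmDiff_eq_sup, Finset.sup_eq_union,
        ← Finset.insert_eq, Finset.prod_insert hγ]
      nlinarith [mul_nonneg (h_nonneg (survivingSigns l)) (Nat.cast_nonneg' (α := ℝ)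
        (l.count (some γ)))]

lemma prod_survivingSigns_cons_cons_mul_le (hg : ∀ γ, 0 ≤ g γ) (p q : Option Γ)
    (l : List (Option Γ)) :
    (∏ α ∈ survivingSigns (q :: p :: l), g α) * (p.elim 1 g * q.elim 1 g) ≤
      (∏ α ∈ survivingSigns l, g α) *
        (labelMass g l p * (labelMass g l q + if p = q then 1 else 0)) := by
  have h_nonneg (u : Finset Γ) : 0 ≤ ∏ α ∈ u, g α := Finset.prod_nonneg fun α _ => hg α
  have hp : 0 ≤ p.elim 1 g := by cases p <;> simp [hg]
  calc (∏ α ∈ survivingSigns (q :: p :: l), g α) * (p.elim 1 g * q.elim 1 g)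
      = (∏ α ∈ survivingSigns (q :: p :: l), g α) * q.elim 1 g * p.elim 1 g := by ring
    _ ≤ (∏ α ∈ survivingSigns (p :: l), g α) * labelMass g (p :: l) q * p.elim 1 g :=
        mul_le_mul_of_nonneg_right (prod_survivingSigns_cons_mul_le hg q (p :: l)) hp
    _ = (∏ α ∈ survivingSigns (p :: l), g α) * p.elim 1 g * labelMass g (p :: l) q := by ring
    _ ≤ (∏ α ∈ survivingSigns l, g α) * labelMass g l p *
          (labelMass g l q + if p = q then 1 else 0) :=
        mul_le_mul (prod_survivingSigns_cons_mul_le hg p l) (labelMass_cons_le g p q l)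
          (labelMass_nonneg _ _ _) (mul_nonneg (h_nonneg _) (labelMass_nonneg _ _ _))
    _ = _ := mul_assoc _ _ _

end LabelMass

section Counting

lemma sum_sum_mul_add_ite {ι R : Type*} [Fintype ι] [DecidableEq ι] [CommSemiring R] (f o : ι → R)
    (D : R) :
    ∑ p, ∑ q, f p * (f q + if p = q then 1 else 0) * (D + o p + o q) =
      (∑ p, f p + 1) * (D * ∑ p, f p + 2 * ∑ p, f p * o p) := by
  have h_inner (p : ι) :
      ∑ q, f p * (f q + if p = q then 1 else 0) * (D + o p + o q) =
        f p * (D * ∑ q, f q + ∑ q, f q * o q + D) + f p * o p * (∑ q, f q + 2) := by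
    have h_term (q : ι) : f p * (f q + if p = q then 1 else 0) * (D + o p + o q) =
        f p * (D + o p) * f q + f p * (f q * o q) +
          if p = q then f p * (D + o p + o q) else 0 := by
      split_ifs <;> ring
    simp only [h_term, Finset.sum_add_distrib, Finset.sum_ite_eq, Finset.mem_univ, if_true,
      ← Finset.mul_sum]
    ring
  rw [Finset.sum_congr rfl fun p _ => h_inner p, Finset.sum_add_distrib, ← Finset.sum_mul,
    ← Finset.sum_mul]
  ring

/-- The bounds that locality provides for the numbers `b a γ` and `b' γ γ'`, which say whether a
jump, or a term, anticommutes with the term `γ`. Here `g γ ^ 2` is the weight of `γ`. -/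
structure InteractionBounds {Γ J : Type} [Fintype Γ] [Fintype J] (g : Γ → ℝ) (b : J → Γ → ℕ)
    (b' : Γ → Γ → ℕ) (M θ : ℝ) : Prop where
  jump_le_one : ∀ a γ, b a γ ≤ 1
  term_le_one : ∀ γ γ', b' γ γ' ≤ 1
  sum_jump_le : ∀ γ, ∑ a, (b a γ : ℝ) ≤ M
  sum_sq_mul_jump_le : ∀ a, ∑ γ, g γ ^ 2 * b a γ ≤ θ
  sum_sq_mul_term_le : ∀ γ', ∑ γ, g γ ^ 2 * b' γ γ' ≤ θ

variable {Γ J : Type}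

/-- The indicator that the Lindblad operator of the jump `a` has a term with label `p`. -/
def jumpIndicator (b : J → Γ → ℕ) (a : J) (p : Option Γ) : ℝ :=
  p.elim 1 fun γ => b a γ

/-- The number of labels in `l` which anticommute with the label `p`. -/
def labelOverlap (b' : Γ → Γ → ℕ) (l : List (Option Γ)) (p : Option Γ) : ℕ :=
  p.elim 0 fun γ => labelSum (b' γ) l

lemma jumpIndicator_nonneg (b : J → Γ → ℕ) (a : J) (p : Option Γ) : 0 ≤ jumpIndicator b a p := by
  cases p <;> simp [jumpIndicator]

variable [Fintype Γ] [DecidableEq Γ] [Fintype J] {g : Γ → ℝ} {b : J → Γ → ℕ} {b' : Γ → Γ → ℕ}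
  {M θ : ℝ}

namespace InteractionBounds

variable (hb : InteractionBounds g b b' M θ) (l : List (Option Γ))
include hb

omit [DecidableEq Γ] in
lemma jumpIndicator_le_one (a : J) (p : Option Γ) : jumpIndicator b a p ≤ 1 := by
  cases p <;> simp [jumpIndicator, hb.jump_le_one a]

lemma sum_labelMass_mul_jumpIndicator_le (a : J) :
    ∑ p, labelMass g l p * jumpIndicator b a p ≤ 1 + θ + l.length := by
  have h_old : labelSum (fun γ => (b a γ : ℝ)) l ≤ l.length := by
    simpa using labelSum_le_length_mul zero_le_one
      (fun γ => Nat.cast_le_one.2 (hb.jump_le_one a γ)) l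
  simp only [Fintype.sum_option, labelMass, jumpIndicator, Option.elim_none, Option.elim_some,
    add_mul, Finset.sum_add_distrib, sum_count_mul, mul_one]
  linarith [hb.sum_sq_mul_jump_le a]

omit [DecidableEq Γ] in
lemma sum_labelSum_jump_le (hM : 0 ≤ M) :
    ∑ a, ((labelSum (b a) l : ℕ) : ℝ) ≤ l.length * M := by
  have h_swap := sum_mul_labelSum Finset.univ (fun _ => (1 : ℝ)) (fun a γ => (b a γ : ℝ)) l
  simp only [one_mul] at h_swap
  simp only [cast_labelSum, h_swap]
  exact labelSum_le_length_mul hM hb.sum_jump_le l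

lemma sum_labelMass_mul_labelSum_term_le (hθ : 0 ≤ θ) :
    ∑ γ, labelMass g l (some γ) * ((labelSum (b' γ) l : ℕ) : ℝ) ≤ l.length * (θ + l.length) := by
  have h_new : ∑ γ, g γ ^ 2 * labelSum (fun γ' => (b' γ γ' : ℝ)) l ≤ l.length * θ := by
    rw [sum_mul_labelSum]
    exact labelSum_le_length_mul hθ hb.sum_sq_mul_term_le l
  have h_old : labelSum (fun γ => labelSum (fun γ' => (b' γ γ' : ℝ)) l) l ≤
      l.length * l.length := by
    refine labelSum_le_length_mul (Nat.cast_nonneg _) (fun γ => ?_) l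
    simpa using labelSum_le_length_mul zero_le_one
      (fun γ' => Nat.cast_le_one.2 (hb.term_le_one γ γ')) l
  simp only [cast_labelSum, labelMass, Option.elim_some, add_mul, Finset.sum_add_distrib,
    sum_count_mul]
  linarith

lemma sum_sum_labelMass_mul_labelOverlap_le (hM : 0 ≤ M) (hθ : 0 ≤ θ) :
    ∑ a, ∑ p, labelMass g l p * jumpIndicator b a p * labelOverlap b' l p ≤
      l.length * (θ + l.length) * M := by
  have h_swap : ∑ a, ∑ p, labelMass g l p * jumpIndicator b a p * labelOverlap b' l p =
      ∑ γ, labelMass g l (some γ) * ((labelSum (b' γ) l : ℕ) : ℝ) * ∑ a, (b a γ : ℝ) := by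
    rw [Finset.sum_comm]
    simp [Fintype.sum_option, labelOverlap, jumpIndicator, Finset.mul_sum, mul_right_comm]
  calc _ = _ := h_swap
    _ ≤ ∑ γ, labelMass g l (some γ) * ((labelSum (b' γ) l : ℕ) : ℝ) * M :=
        Finset.sum_le_sum fun γ _ => mul_le_mul_of_nonneg_left (hb.sum_jump_le γ)
          (mul_nonneg (labelMass_nonneg _ _ _) (Nat.cast_nonneg _))
    _ ≤ _ := by
        rw [← Finset.sum_mul]
        exact mul_le_mul_of_nonneg_right (hb.sum_labelMass_mul_labelSum_term_le l hθ) hM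

lemma sum_sum_labelMass_mul_le (a : J) :
    ∑ p, ∑ q, labelMass g l p * (labelMass g l q + if p = q then 1 else 0) *
        (jumpIndicator b a p * jumpIndicator b a q *
          (2 * labelSum (b a) l + labelOverlap b' l p + labelOverlap b' l q)) ≤
      2 * (l.length + θ + 2) * ((l.length + θ + 1) * labelSum (b a) l +
        ∑ p, labelMass g l p * jumpIndicator b a p * labelOverlap b' l p) := by
  set f : Option Γ → ℝ := fun p => labelMass g l p * jumpIndicator b a p with hf
  have hf_nonneg (p : Option Γ) : 0 ≤ f p :=
    mul_nonneg (labelMass_nonneg _ _ _) (jumpIndicator_nonneg _ _ _)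
  have hf_sum : ∑ p, f p ≤ l.length + θ + 1 := by
    linarith [hb.sum_labelMass_mul_jumpIndicator_le l a]
  have h_sum_nonneg : 0 ≤ ∑ p, f p := Finset.sum_nonneg fun p _ => hf_nonneg p
  have h_overlap_nonneg : 0 ≤ ∑ p, f p * labelOverlap b' l p :=
    Finset.sum_nonneg fun p _ => mul_nonneg (hf_nonneg p) (Nat.cast_nonneg _)
  calc _ ≤ ∑ p, ∑ q, f p * (f q + if p = q then 1 else 0) *
          (2 * labelSum (b a) l + labelOverlap b' l p + labelOverlap b' l q) := by
        refine Finset.sum_le_sum fun p _ => Finset.sum_le_sum fun q _ => ?_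
        have h_delta : (if p = q then 1 else 0) * jumpIndicator b a q ≤
            (if p = q then 1 else 0 : ℝ) :=
          mul_le_of_le_one_right (by split_ifs <;> norm_num) (hb.jumpIndicator_le_one a q)
        calc _ = f p * (f q + (if p = q then 1 else 0) * jumpIndicator b a q) *
              (2 * labelSum (b a) l + labelOverlap b' l p + labelOverlap b' l q) := by
              rw [hf]; ring
          _ ≤ _ := by have := hf_nonneg p; gcongr
    _ = (∑ p, f p + 1) * (2 * labelSum (b a) l * ∑ p, f p + 2 * ∑ p, f p * labelOverlap b' l p) :=
        sum_sum_mul_add_ite f _ _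
    _ ≤ (l.length + θ + 1 + 1) * (2 * labelSum (b a) l * (l.length + θ + 1) +
          2 * ∑ p, f p * labelOverlap b' l p) := by
        gcongr
        linarith
    _ = _ := by ring

lemma sum_sum_sum_labelMass_mul_le (hM : 0 ≤ M) (hθ : 0 ≤ θ) :
    ∑ a, ∑ p, ∑ q, labelMass g l p * (labelMass g l q + if p = q then 1 else 0) *
        (jumpIndicator b a p * jumpIndicator b a q *
          (2 * labelSum (b a) l + labelOverlap b' l p + labelOverlap b' l q)) ≤
      2 * l.length * (l.length + θ + 2) * (2 * l.length + 2 * θ + 1) * M := by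
  refine (Finset.sum_le_sum fun a _ => hb.sum_sum_labelMass_mul_le l a).trans ?_
  rw [← Finset.mul_sum, Finset.sum_add_distrib, ← Finset.mul_sum]
  calc _ ≤ 2 * (l.length + θ + 2) *
        ((l.length + θ + 1) * (l.length * M) + l.length * (θ + l.length) * M) := by
        gcongr
        · exact hb.sum_labelSum_jump_le l hM
        · exact hb.sum_sum_labelMass_mul_labelOverlap_le l hM hθ
    _ = _ := by ring

end InteractionBounds

end Counting

section Signs

lemma norm_one_sub_neg_one_pow_le (n : ℕ) : ‖1 - (-1 : ℂ) ^ n‖ ≤ 2 * n := by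
  rcases n.eq_zero_or_pos with rfl | hn
  · simp
  · have h_one_le : (1 : ℝ) ≤ n := by exact_mod_cast hn
    calc ‖1 - (-1 : ℂ) ^ n‖ ≤ ‖(1 : ℂ)‖ + ‖(-1 : ℂ) ^ n‖ := norm_sub_le _ _
      _ = 2 := by norm_num
      _ ≤ 2 * n := by linarith

/-- The factor that the dissipator of `P = A * G` and `Q = A * G'` produces from an operator which
passes through `A`, `G` and `G'` with the signs `(-1) ^ m`, `(-1) ^ n` and `(-1) ^ n'`. -/
noncomputable def dissipatorFactor (m n n' : ℕ) : ℂ :=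
  (-1) ^ m * (-1) ^ n - ((-1) ^ n * (-1) ^ n' + 1) / 2

lemma norm_dissipatorFactor_le (m n n' : ℕ) : ‖dissipatorFactor m n n'‖ ≤ 2 * m + n + n' := by
  have h_sq : (-1 : ℂ) ^ n * (-1) ^ n = 1 := by rw [← mul_pow]; norm_num
  have h_factor : dissipatorFactor m n n' = (-1) ^ n *
      ((1 - (-1) ^ n) / 2 + (1 - (-1) ^ n') / 2 - (1 - (-1) ^ m)) := by
    rw [dissipatorFactor]
    linear_combination (1 / 2 : ℂ) * h_sq
  rw [h_factor, norm_mul, norm_pow, norm_neg, norm_one, one_pow, one_mul]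
  refine (norm_sub_le _ _).trans ?_
  have h_add := norm_add_le ((1 - (-1 : ℂ) ^ n) / 2) ((1 - (-1 : ℂ) ^ n') / 2)
  simp only [norm_div, Complex.norm_two] at h_add
  linarith [norm_one_sub_neg_one_pow_le m, norm_one_sub_neg_one_pow_le n,
    norm_one_sub_neg_one_pow_le n']

lemma mul_eq_neg_one_pow_smul_of_lie_eq {R : Type*} [Ring R] [Algebra ℂ R] {X Y : R} {β : ℕ}
    (hβ : β = 0 ∨ β = 1) (hXY : ⁅X, Y⁆ = (β : ℂ) • ((2 : ℂ) • (X * Y))) :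
    X * Y = (-1 : ℂ) ^ β • (Y * X) := by
  rw [Ring.lie_def] at hXY
  rcases hβ with rfl | rfl
  · simpa [sub_eq_zero] using hXY
  · rw [Nat.cast_one, one_smul, two_smul, sub_eq_iff_eq_add, add_assoc, left_eq_add] at hXY
    rw [pow_one, neg_one_smul]
    exact eq_neg_of_add_eq_zero_left hXY

lemma mul_mul_eq_smul_of_mul_eq_smul {R : Type*} [Ring R] [Algebra ℂ R] {X Y Z : R} {c d : ℂ}
    (hX : Z * X = c • (X * Z)) (hY : Z * Y = d • (Y * Z)) :
    Z * (X * Y) = (d * c) • (X * Y * Z) := by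
  rw [← mul_assoc, hX, smul_mul_assoc, mul_assoc, hY, mul_smul_comm, smul_smul, mul_assoc,
    mul_comm c]

variable {V : Type} [NormedAddCommGroup V] [InnerProductSpace ℂ V] [CompleteSpace V]

lemma dissipator_mul_mul {A G G' X : V →L[ℂ] V} (hA : IsSelfAdjoint A) (hA_sq : A * A = 1)
    (hG : IsSelfAdjoint G) {m n n' : ℕ} (hAX : A * X = (-1 : ℂ) ^ m • (X * A))
    (hGX : G * X = (-1 : ℂ) ^ n • (X * G)) (hGX' : G' * X = (-1 : ℂ) ^ n' • (X * G')) :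
    dissipator (A * G) (A * G') X = dissipatorFactor m n n' • (X * G * G') := by
  have h_star : star (A * G) = G * A := by rw [star_mul, hA.star_eq, hG.star_eq]
  have h_conj : G * A * X * (A * G') = ((-1 : ℂ) ^ m * (-1) ^ n) • (X * G * G') := by
    calc G * A * X * (A * G') = G * (A * X) * (A * G') := by simp only [mul_assoc]
      _ = (-1 : ℂ) ^ m • (G * X * (A * A) * G') := by
        rw [hAX]; simp only [mul_smul_comm, smul_mul_assoc, mul_assoc]
      _ = _ := by rw [hA_sq, hGX, mul_one, smul_mul_assoc, smul_smul]
  have h_mul : G * A * (A * G') = G * G' := by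
    rw [mul_assoc, ← mul_assoc A, hA_sq, one_mul]
  have h_left : G * G' * X = ((-1 : ℂ) ^ n * (-1) ^ n') • (X * G * G') := by
    rw [mul_assoc, hGX', mul_smul_comm, ← mul_assoc, hGX, smul_mul_assoc, smul_smul, mul_comm]
  rw [dissipator, dissipatorFactor, h_star, h_conj, h_mul, h_left, ← mul_assoc]
  module

end Signs

section CommutationSigns

variable {V : Type} [NormedAddCommGroup V] [InnerProductSpace ℂ V] {Γ J : Type}

/-- `X` commutes with the jumps and the Hamiltonian terms up to the signs of a product of
Hamiltonian terms with labels `l`. -/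
structure CommutationSigns (H : Γ → (V →L[ℂ] V)) (A : J → (V →L[ℂ] V)) (b : J → Γ → ℕ)
    (b' : Γ → Γ → ℕ) (l : List (Option Γ)) (X : V →L[ℂ] V) : Prop where
  jump_mul : ∀ a, A a * X = (-1 : ℂ) ^ labelSum (b a) l • (X * A a)
  term_mul : ∀ γ, H γ * X = (-1 : ℂ) ^ labelSum (b' γ) l • (X * H γ)

variable {H : Γ → (V →L[ℂ] V)} {A : J → (V →L[ℂ] V)} {b : J → Γ → ℕ} {b' : Γ → Γ → ℕ}
  {l : List (Option Γ)} {X : V →L[ℂ] V}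

namespace CommutationSigns

lemma smul (hX : CommutationSigns H A b b' l X) (c : ℂ) :
    CommutationSigns H A b b' l (c • X) where
  jump_mul a := by rw [mul_smul_comm, hX.jump_mul, smul_mul_assoc, smul_comm]
  term_mul γ := by rw [mul_smul_comm, hX.term_mul, smul_mul_assoc, smul_comm]

lemma elim_mul (hX : CommutationSigns H A b b' l X) (p : Option Γ) :
    p.elim 1 H * X = (-1 : ℂ) ^ labelOverlap b' l p • (X * p.elim 1 H) := by
  cases p with
  | none => simp [labelOverlap]
  | some γ => exact hX.term_mul γ

end CommutationSigns

variable [CompleteSpace V] {n : ℕ} {𝒜 : Fin n → Subalgebra ℂ (V →L[ℂ] V)}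

lemma CommutationCondition.commutationSigns_term (hc : CommutationCondition 𝒜 H A b b')
    (γ : Γ) :
    CommutationSigns H A b b' [some γ] (H γ) where
  jump_mul a := by
    simpa [labelSum] using mul_eq_neg_one_pow_smul_of_lie_eq (hc.jump_mem a γ) (hc.jump_comm a γ)
  term_mul γ' := by
    simpa [labelSum] using
      mul_eq_neg_one_pow_smul_of_lie_eq (hc.term_mem γ' γ) (hc.term_comm γ' γ)

lemma CommutationSigns.mul_elim (hX : CommutationSigns H A b b' l X)
    (hc : CommutationCondition 𝒜 H A b b') (p : Option Γ) :
    CommutationSigns H A b b' (p :: l) (X * p.elim 1 H) := by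
  cases p with
  | none =>
    exact ⟨by simpa [labelSum_cons] using hX.jump_mul, by simpa [labelSum_cons] using hX.term_mul⟩
  | some γ =>
    constructor
    · intro a
      rw [labelSum_cons, pow_add]
      exact mul_mul_eq_smul_of_mul_eq_smul (hX.jump_mul a)
        (mul_eq_neg_one_pow_smul_of_lie_eq (hc.jump_mem a γ) (hc.jump_comm a γ))
    · intro γ'
      rw [labelSum_cons, pow_add]
      exact mul_mul_eq_smul_of_mul_eq_smul (hX.term_mul γ')
        (mul_eq_neg_one_pow_smul_of_lie_eq (hc.term_mem γ' γ) (hc.term_comm γ' γ))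

end CommutationSigns

section NormBound

variable {V : Type} [NormedAddCommGroup V] [InnerProductSpace ℂ V] [CompleteSpace V]
  {Γ J : Type} {n : ℕ} {𝒜 : Fin n → Subalgebra ℂ (V →L[ℂ] V)}
  {H : Γ → (V →L[ℂ] V)} {A : J → (V →L[ℂ] V)} {b : J → Γ → ℕ} {b' : Γ → Γ → ℕ}
  {l : List (Option Γ)} {X : V →L[ℂ] V} {h : Γ → ℝ} {y : ℝ}

/-- The scalar in front of `A a * H p` in the coefficient with label `p` of a Lindblad operator,
with `H none = 1`. -/
noncomputable def jumpAmplitude (b : J → Γ → ℕ) (y : ℝ) (a : J) (p : Option Γ) : ℂ :=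
  p.elim 1 fun γ => y * b a γ * 2

lemma CommutationCondition.lindbladOperatorCoeff_eq (hc : CommutationCondition 𝒜 H A b b')
    (a : J) (p : Option Γ) :
    lindbladOperatorCoeff H A y a p = jumpAmplitude b y a p • (A a * p.elim 1 H) := by
  cases p with
  | none => simp [lindbladOperatorCoeff, jumpAmplitude]
  | some γ => simp [lindbladOperatorCoeff, jumpAmplitude, hc.jump_comm, smul_smul, mul_assoc]

lemma SquareCondition.norm_le (hs : SquareCondition H h) (γ : Γ) : ‖H γ‖ ≤ h γ := by
  refine le_of_sq_le_sq ?_ (hs.nonneg γ)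
  calc ‖H γ‖ ^ 2 = ‖H γ * H γ‖ := by rw [(hs.isSelfAdjoint γ).norm_mul_self]
    _ = h γ ^ 2 * ‖(1 : V →L[ℂ] V)‖ := by simp [hs.sq_eq, norm_smul]
    _ ≤ h γ ^ 2 := mul_le_of_le_one_right (sq_nonneg _) ContinuousLinearMap.norm_id_le

lemma SquareCondition.norm_jumpAmplitude_mul_norm_le (hs : SquareCondition H h) (a : J)
    (p : Option Γ) :
    ‖jumpAmplitude b y a p‖ * ‖p.elim 1 H‖ ≤
      2 * (p.elim 1 (fun γ => h γ * |y|) * jumpIndicator b a p) := by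
  cases p with
  | none =>
    have h_one : ‖(1 : V →L[ℂ] V)‖ ≤ 1 := ContinuousLinearMap.norm_id_le
    simp only [jumpAmplitude, jumpIndicator, Option.elim_none, norm_one]
    linarith
  | some γ =>
    simp only [jumpAmplitude, jumpIndicator, Option.elim_some, norm_mul, Complex.norm_real,
      Complex.norm_natCast, Complex.norm_two, Real.norm_eq_abs]
    calc |y| * b a γ * 2 * ‖H γ‖ ≤ |y| * b a γ * 2 * h γ := by
          gcongr
          exact hs.norm_le γ
      _ = _ := by ring

lemma CommutationSigns.dissipator_lindbladOperatorCoeff (hX : CommutationSigns H A b b' l X)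
    (hs : SquareCondition H h) (hc : CommutationCondition 𝒜 H A b b') (a : J) (p q : Option Γ) :
    dissipator (lindbladOperatorCoeff H A y a p) (lindbladOperatorCoeff H A y a q) X =
      (star (jumpAmplitude b y a p) * jumpAmplitude b y a q *
        dissipatorFactor (labelSum (b a) l) (labelOverlap b' l p) (labelOverlap b' l q)) •
        (X * p.elim 1 H * q.elim 1 H) := by
  have h_selfAdjoint : IsSelfAdjoint (p.elim 1 H) := by
    cases p with
    | none => exact .one _
    | some γ => exact hs.isSelfAdjoint γ
  have h_smul := dissipator_smul_smul_smul (jumpAmplitude b y a p) (jumpAmplitude b y a q) 1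
    (A a * p.elim 1 H) (A a * q.elim 1 H) X
  rw [one_smul, mul_one] at h_smul
  rw [hc.lindbladOperatorCoeff_eq, hc.lindbladOperatorCoeff_eq, h_smul,
    dissipator_mul_mul (hc.jump_isSelfAdjoint a) (hc.jump_sq a) h_selfAdjoint (hX.jump_mul a)
      (hX.elim_mul p) (hX.elim_mul q), smul_smul]

variable [Fintype J]

lemma CommutationSigns.lindbladianCoeff_apply (hX : CommutationSigns H A b b' l X)
    (hs : SquareCondition H h) (hc : CommutationCondition 𝒜 H A b b') (p q : Option Γ) :
    CommutationSigns H A b b' (q :: p :: l) (lindbladianCoeff H A y p q X) := by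
  simp only [lindbladianCoeff, hX.dissipator_lindbladOperatorCoeff hs hc,
    ← Finset.sum_smul]
  exact ((hX.mul_elim hc p).mul_elim hc q).smul _

lemma CommutationSigns.norm_lindbladianCoeff_le (hX : CommutationSigns H A b b' l X)
    (hs : SquareCondition H h) (hc : CommutationCondition 𝒜 H A b b') (p q : Option Γ) :
    ‖lindbladianCoeff H A y p q X‖ ≤
      4 * (p.elim 1 (fun γ => h γ * |y|) * q.elim 1 (fun γ => h γ * |y|)) *
        (∑ a, jumpIndicator b a p * jumpIndicator b a q *
          (2 * ((labelSum (b a) l : ℕ) : ℝ) + labelOverlap b' l p + labelOverlap b' l q)) *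
        ‖X‖ := by
  simp only [lindbladianCoeff, hX.dissipator_lindbladOperatorCoeff hs hc,
    Finset.mul_sum, Finset.sum_mul]
  refine norm_sum_le_of_le _ fun a _ => ?_
  have hp := hs.norm_jumpAmplitude_mul_norm_le (b := b) (y := y) a p
  have hq := hs.norm_jumpAmplitude_mul_norm_le (b := b) (y := y) a q
  have h_factor := norm_dissipatorFactor_le (labelSum (b a) l) (labelOverlap b' l p)
    (labelOverlap b' l q)
  set κ := dissipatorFactor (labelSum (b a) l) (labelOverlap b' l p) (labelOverlap b' l q)
  rw [norm_smul, norm_mul, norm_mul, norm_star]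
  calc _ ≤ ‖jumpAmplitude b y a p‖ * ‖jumpAmplitude b y a q‖ * ‖κ‖ *
        (‖X‖ * ‖p.elim 1 H‖ * ‖q.elim 1 H‖) := by
        gcongr
        exact (norm_mul_le _ _).trans (by gcongr; exact norm_mul_le _ _)
    _ = (‖jumpAmplitude b y a p‖ * ‖p.elim 1 H‖) * (‖jumpAmplitude b y a q‖ * ‖q.elim 1 H‖) *
        ‖κ‖ * ‖X‖ := by ring
    _ ≤ (2 * (p.elim 1 (fun γ => h γ * |y|) * jumpIndicator b a p)) *
        (2 * (q.elim 1 (fun γ => h γ * |y|) * jumpIndicator b a q)) *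
        (2 * ((labelSum (b a) l : ℕ) : ℝ) + labelOverlap b' l p + labelOverlap b' l q) *
        ‖X‖ := by
        have h_nonneg (r : Option Γ) : 0 ≤ ‖jumpAmplitude b y a r‖ * ‖r.elim 1 H‖ := by positivity
        have hp_nonneg := (h_nonneg p).trans hp
        have hq_nonneg := (h_nonneg q).trans hq
        gcongr
    _ = _ := by ring

end NormBound

section Estimate

variable {V : Type} [NormedAddCommGroup V] [InnerProductSpace ℂ V] [CompleteSpace V]
  {Γ J : Type} [Fintype Γ] [DecidableEq Γ] [Fintype J]
  {n : ℕ} {𝒜 : Fin n → Subalgebra ℂ (V →L[ℂ] V)}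
  {H : Γ → (V →L[ℂ] V)} {A : J → (V →L[ℂ] V)} {b : J → Γ → ℕ} {b' : Γ → Γ → ℕ}
  {l : List (Option Γ)} {X : V →L[ℂ] V} {h : Γ → ℝ} {y M θ : ℝ}

/-- The growth of the weighted norm when a Lindbladian is applied to a product of `N` terms, in
units of the number `M` of jumps that anticommute with a term. -/
def growthFactor (N : ℕ) (θ : ℝ) : ℝ :=
  8 * N * (N + θ + 2) * (2 * N + 2 * θ + 1)

lemma CommutationSigns.prod_mul_norm_lindbladianCoeff_le (hX : CommutationSigns H A b b' l X)
    (hs : SquareCondition H h) (hc : CommutationCondition 𝒜 H A b b') (p q : Option Γ) :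
    (∏ α ∈ survivingSigns (q :: p :: l), h α * |y|) *
        ‖lindbladianCoeff H A y p q X‖ ≤
      4 * ((∏ α ∈ survivingSigns l, h α * |y|) * ‖X‖) *
        ∑ a, labelMass (fun γ => h γ * |y|) l p *
          (labelMass (fun γ => h γ * |y|) l q + if p = q then 1 else 0) *
          (jumpIndicator b a p * jumpIndicator b a q *
            (2 * ((labelSum (b a) l : ℕ) : ℝ) + labelOverlap b' l p + labelOverlap b' l q)) := by
  have hg (γ : Γ) : 0 ≤ h γ * |y| := mul_nonneg (hs.nonneg γ) (abs_nonneg y)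
  set S : ℝ := ∑ a, jumpIndicator b a p * jumpIndicator b a q *
    (2 * ((labelSum (b a) l : ℕ) : ℝ) + labelOverlap b' l p + labelOverlap b' l q)
  have hS : 0 ≤ S := Finset.sum_nonneg fun a _ => mul_nonneg
    (mul_nonneg (jumpIndicator_nonneg b a p) (jumpIndicator_nonneg b a q)) (by positivity)
  rw [← Finset.mul_sum]
  calc _ ≤ (∏ α ∈ survivingSigns (q :: p :: l), h α * |y|) *
        (4 * (p.elim 1 (fun γ => h γ * |y|) * q.elim 1 (fun γ => h γ * |y|)) * S * ‖X‖) :=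
        mul_le_mul_of_nonneg_left (hX.norm_lindbladianCoeff_le hs hc p q)
          (Finset.prod_nonneg fun α _ => hg α)
    _ = (∏ α ∈ survivingSigns (q :: p :: l), h α * |y|) *
        (p.elim 1 (fun γ => h γ * |y|) * q.elim 1 (fun γ => h γ * |y|)) * (4 * S * ‖X‖) := by ring
    _ ≤ _ := mul_le_mul_of_nonneg_right (prod_survivingSigns_cons_cons_mul_le hg p q l)
        (by positivity)
    _ = _ := by ring

lemma CommutationSigns.sum_prod_mul_norm_lindbladianCoeff_le
    (hX : CommutationSigns H A b b' l X) (hs : SquareCondition H h)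
    (hc : CommutationCondition 𝒜 H A b b')
    (hb : InteractionBounds (fun γ => h γ * |y|) b b' M θ) (hM : 0 ≤ M) (hθ : 0 ≤ θ) :
    ∑ q, ∑ p, (∏ α ∈ survivingSigns (q :: p :: l), h α * |y|) *
        ‖lindbladianCoeff H A y p q X‖ ≤
      growthFactor l.length θ * M * ((∏ α ∈ survivingSigns l, h α * |y|) * ‖X‖) := by
  have h_nonneg : 0 ≤ (∏ α ∈ survivingSigns l, h α * |y|) * ‖X‖ :=
    mul_nonneg (Finset.prod_nonneg fun α _ => mul_nonneg (hs.nonneg α) (abs_nonneg y))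
      (norm_nonneg X)
  rw [Finset.sum_comm]
  refine (Finset.sum_le_sum fun p _ => Finset.sum_le_sum fun q _ =>
    hX.prod_mul_norm_lindbladianCoeff_le hs hc p q).trans ?_
  have h_swap (c : ℝ) (F : Option Γ → Option Γ → J → ℝ) :
      ∑ p, ∑ q, c * ∑ a, F p q a = c * ∑ a, ∑ p, ∑ q, F p q a := by
    simp only [← Finset.mul_sum]
    rw [Finset.sum_congr rfl fun p _ => Finset.sum_comm, Finset.sum_comm]
  rw [h_swap]
  refine (mul_le_mul_of_nonneg_left (hb.sum_sum_sum_labelMass_mul_le l hM hθ)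
    (by positivity)).trans_eq ?_
  rw [growthFactor]
  ring

lemma sum_prod_mul_norm_expansionCoeff_le_sum (hh : ∀ γ, 0 ≤ h γ) :
    ∑ U : Finset Γ with U.card ≤ 5, (∏ α ∈ U, h α * |y|) * ‖expansionCoeff H A y U‖ ≤
      ∑ x : ExpansionIndex Γ, (∏ α ∈ survivingSigns x.labels, h α * |y|) *
        ‖expansionTerm H A y x‖ := by
  have h_maps (x : ExpansionIndex Γ) (_ : x ∈ Finset.univ) :
      survivingSigns x.labels ∈ ({U | U.card ≤ 5} : Finset (Finset Γ)) := by
    simpa using card_survivingSigns_labels_le x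
  rw [← Finset.sum_fiberwise_of_maps_to h_maps]
  refine Finset.sum_le_sum fun U _ => ?_
  calc (∏ α ∈ U, h α * |y|) * ‖expansionCoeff H A y U‖
      ≤ (∏ α ∈ U, h α * |y|) *
          ∑ x : ExpansionIndex Γ with survivingSigns x.labels = U, ‖expansionTerm H A y x‖ := by
        rw [expansionCoeff_eq_sum]
        exact mul_le_mul_of_nonneg_left (norm_sum_le _ _)
          (Finset.prod_nonneg fun α _ => mul_nonneg (hh α) (abs_nonneg y))
    _ = _ := by
        rw [Finset.mul_sum]
        refine Finset.sum_congr rfl fun x hx => ?_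
        rw [(Finset.mem_filter.1 hx).2]

lemma sum_prod_mul_norm_expansionTerm_le (hs : SquareCondition H h)
    (hc : CommutationCondition 𝒜 H A b b')
    (hb : InteractionBounds (fun γ => h γ * |y|) b b' M θ) (hM : 0 ≤ M) (hθ : 0 ≤ θ) :
    ∑ x : ExpansionIndex Γ, (∏ α ∈ survivingSigns x.labels, h α * |y|) *
        ‖expansionTerm H A y x‖ ≤
      growthFactor 1 θ * growthFactor 3 θ * M ^ 2 * (|y| * ∑ γ, h γ ^ 2) := by
  have h_growth : 0 ≤ growthFactor 3 θ * M := by rw [growthFactor]; positivity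
  have h_growth_sq : 0 ≤ growthFactor 3 θ * M * (growthFactor 1 θ * M) := by
    rw [growthFactor, growthFactor]; positivity
  calc _ = ∑ γ₀, ∑ p₁, ∑ p₂, ∑ p₃, ∑ p₄,
        (∏ α ∈ survivingSigns [p₃, p₄, p₁, p₂, some γ₀], h α * |y|) *
          ‖lindbladianCoeff H A y p₄ p₃ (lindbladianCoeff H A y p₂ p₁ (H γ₀))‖ := by
        simp only [Fintype.sum_prod_type, ExpansionIndex.labels, expansionTerm]
    _ ≤ ∑ γ₀, ∑ p₁, ∑ p₂, growthFactor 3 θ * M *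
          ((∏ α ∈ survivingSigns [p₁, p₂, some γ₀], h α * |y|) *
            ‖lindbladianCoeff H A y p₂ p₁ (H γ₀)‖) :=
        Finset.sum_le_sum fun γ₀ _ => Finset.sum_le_sum fun p₁ _ => Finset.sum_le_sum fun p₂ _ =>
          ((hc.commutationSigns_term γ₀).lindbladianCoeff_apply hs hc p₂ p₁
            ).sum_prod_mul_norm_lindbladianCoeff_le hs hc hb hM hθ
    _ ≤ ∑ γ₀, growthFactor 3 θ * M * (growthFactor 1 θ * M *
          ((∏ α ∈ survivingSigns [some γ₀], h α * |y|) * ‖H γ₀‖)) := by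
        refine Finset.sum_le_sum fun γ₀ _ => ?_
        simp only [← Finset.mul_sum]
        exact mul_le_mul_of_nonneg_left ((hc.commutationSigns_term γ₀
          ).sum_prod_mul_norm_lindbladianCoeff_le hs hc hb hM hθ) h_growth
    _ ≤ ∑ γ₀, growthFactor 3 θ * M * (growthFactor 1 θ * M) * (|y| * h γ₀ ^ 2) := by
        refine Finset.sum_le_sum fun γ₀ _ => ?_
        have h_single : ∏ α ∈ survivingSigns [some γ₀], h α * |y| = h γ₀ * |y| := by
          simp [survivingSigns_cons, survivingSigns_nil, ← Finset.bot_eq_empty]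
        have h_norm := mul_le_mul_of_nonneg_left (hs.norm_le γ₀)
          (mul_nonneg (hs.nonneg γ₀) (abs_nonneg y))
        rw [h_single, ← mul_assoc (growthFactor 3 θ * M)]
        exact mul_le_mul_of_nonneg_left (h_norm.trans_eq (by ring)) h_growth_sq
    _ = _ := by
        rw [← Finset.mul_sum, ← Finset.mul_sum]
        ring

end Estimate

section Locality

variable {V : Type} [NormedAddCommGroup V] [InnerProductSpace ℂ V] {Γ J : Type} {n k : ℕ}
  {𝒜 : Fin n → Subalgebra ℂ (V →L[ℂ] V)} {H : Γ → (V →L[ℂ] V)} {A : J → (V →L[ℂ] V)}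
  {b : J → Γ → ℕ} {b' : Γ → Γ → ℕ} {h : Γ → ℝ} {y aloc aac θ : ℝ}

open Classical in
lemma sum_sq_le_localEnergy_sq [Fintype Γ] (i : Fin n) :
    ∑ γ with i ∈ support 𝒜 (H γ), h γ ^ 2 ≤ localEnergy 𝒜 H h ^ 2 :=
  (Real.sqrt_le_iff.1 (le_ciSup
    (f := fun i : Fin n => √(∑ γ with i ∈ support 𝒜 (H γ), h γ ^ 2))
    (Set.finite_range _).bddAbove i)).2

lemma sum_sq_mul_le_of_support_inter [Fintype Γ] (Z : Finset (Fin n)) {f : Γ → ℕ}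
    (hf : ∀ γ, f γ ≤ 1) (hZ : ∀ γ, f γ ≠ 0 → ∃ i ∈ Z, i ∈ support 𝒜 (H γ)) :
    ∑ γ, (h γ * |y|) ^ 2 * f γ ≤ y ^ 2 * localEnergy 𝒜 H h ^ 2 * Z.card := by
  classical
  calc _ ≤ ∑ γ, ∑ i ∈ Z, if i ∈ support 𝒜 (H γ) then y ^ 2 * h γ ^ 2 else 0 := by
        refine Finset.sum_le_sum fun γ _ => ?_
        have h_nonneg (i : Fin n) (_ : i ∈ Z) :
            0 ≤ if i ∈ support 𝒜 (H γ) then y ^ 2 * h γ ^ 2 else 0 := by positivity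
        rcases eq_or_ne (f γ) 0 with h_zero | h_ne
        · simpa [h_zero] using Finset.sum_nonneg h_nonneg
        · obtain ⟨i, hiZ, hi⟩ := hZ γ h_ne
          have h_one : f γ = 1 := le_antisymm (hf γ) (Nat.one_le_iff_ne_zero.2 h_ne)
          have h_single := Finset.single_le_sum h_nonneg hiZ
          rw [if_pos hi] at h_single
          rwa [h_one, Nat.cast_one, mul_one, mul_pow, sq_abs, mul_comm]
    _ = ∑ i ∈ Z, y ^ 2 * ∑ γ with i ∈ support 𝒜 (H γ), h γ ^ 2 := by
        rw [Finset.sum_comm]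
        simp only [Finset.mul_sum, Finset.sum_filter, mul_ite, mul_zero]
    _ ≤ ∑ _i ∈ Z, y ^ 2 * localEnergy 𝒜 H h ^ 2 :=
        Finset.sum_le_sum fun i _ =>
          mul_le_mul_of_nonneg_left (sum_sq_le_localEnergy_sq i) (sq_nonneg y)
    _ = _ := by rw [Finset.sum_const, nsmul_eq_mul, mul_comm]

variable [Fintype J]

lemma LocalityCondition.one_le_aloc [Nonempty J]
    (hl : LocalityCondition 𝒜 H A b k aloc aac) : 1 ≤ aloc := by
  obtain ⟨a⟩ := ‹Nonempty J›
  obtain ⟨i, hi⟩ := hl.jump_single a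
  have h_count := hl.jump_count {i}
  have h_mem : a ∈ jumpsMeeting 𝒜 A {i} := by simp [jumpsMeeting, hi]
  rw [Finset.card_singleton, Nat.cast_one, mul_one] at h_count
  rw [← h_count, Nat.one_le_cast, Nat.one_le_iff_ne_zero]
  exact Set.ncard_ne_zero_of_mem h_mem

lemma LocalityCondition.sum_jump_le (hl : LocalityCondition 𝒜 H A b k aloc aac) (γ : Γ) :
    ∑ a, (b a γ : ℝ) ≤ aloc * k := by
  have h_count := hl.anticomm_count γ
  push_cast at h_count
  rw [h_count]
  exact mul_le_mul_of_nonneg_right hl.aac_le_aloc k.cast_nonneg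

variable [Fintype Γ] [CompleteSpace V]

lemma LocalityCondition.sum_sq_mul_jump_le (hl : LocalityCondition 𝒜 H A b k aloc aac)
    (hc : CommutationCondition 𝒜 H A b b') (a : J) :
    ∑ γ, (h γ * |y|) ^ 2 * b a γ ≤ y ^ 2 * localEnergy 𝒜 H h ^ 2 * k := by
  obtain ⟨i, hi⟩ := hl.jump_single a
  have h_mem (γ : Γ) (hγ : b a γ ≠ 0) : i ∈ support 𝒜 (H γ) := by
    by_contra h_not_mem
    exact hγ (hc.jump_disjoint a γ (by simpa [hi] using h_not_mem))
  rcases k.eq_zero_or_pos with rfl | hk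
  · have h_zero (γ : Γ) : b a γ = 0 := by
      by_contra hγ
      exact Set.ncard_ne_zero_of_mem (h_mem γ hγ) (Set.toFinite _) (hl.term_card γ)
    simp [h_zero]
  · refine (sum_sq_mul_le_of_support_inter {i} (fun γ => ?_) fun γ hγ =>
      ⟨i, Finset.mem_singleton_self i, h_mem γ hγ⟩).trans ?_
    · rcases hc.jump_mem a γ with h | h <;> omega
    · gcongr
      exact_mod_cast hk

lemma LocalityCondition.sum_sq_mul_term_le (hl : LocalityCondition 𝒜 H A b k aloc aac)
    (hc : CommutationCondition 𝒜 H A b b') (γ' : Γ) :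
    ∑ γ, (h γ * |y|) ^ 2 * b' γ γ' ≤ y ^ 2 * localEnergy 𝒜 H h ^ 2 * k := by
  classical
  have h_card : (support 𝒜 (H γ')).toFinset.card = k := by
    rw [← Set.ncard_eq_toFinset_card', hl.term_card]
  rw [← h_card]
  refine sum_sq_mul_le_of_support_inter _ (fun γ => ?_) fun γ hγ => ?_
  · rcases hc.term_mem γ γ' with h | h <;> omega
  · obtain ⟨i, hi, hi'⟩ := Set.not_disjoint_iff.1 fun hd => hγ (hc.term_disjoint γ γ' hd)
    exact ⟨i, Set.mem_toFinset.2 hi', hi⟩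

lemma LocalityCondition.interactionBounds [Nonempty J]
    (hl : LocalityCondition 𝒜 H A b k aloc aac) (hc : CommutationCondition 𝒜 H A b b')
    (hy : y ^ 2 * localEnergy 𝒜 H h ^ 2 * aloc * k ≤ θ) :
    InteractionBounds (fun γ => h γ * |y|) b b' (aloc * k) θ := by
  have h_energy : y ^ 2 * localEnergy 𝒜 H h ^ 2 * k ≤ θ := by
    refine le_trans ?_ hy
    exact mul_le_mul_of_nonneg_right (le_mul_of_one_le_right (by positivity) hl.one_le_aloc)
      k.cast_nonneg
  exact {
    jump_le_one a γ := by rcases hc.jump_mem a γ with h | h <;> omega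
    term_le_one γ γ' := by rcases hc.term_mem γ γ' with h | h <;> omega
    sum_jump_le := hl.sum_jump_le
    sum_sq_mul_jump_le a := (hl.sum_sq_mul_jump_le hc a).trans h_energy
    sum_sq_mul_term_le γ' := (hl.sum_sq_mul_term_le hc γ').trans h_energy }

end Locality

section Main

variable {V : Type} [NormedAddCommGroup V] [InnerProductSpace ℂ V] [CompleteSpace V]
  {Γ J : Type} [Fintype Γ] [DecidableEq Γ] [Fintype J] {n k : ℕ} {aloc aac y θ : ℝ}
  {𝒜 : Fin n → Subalgebra ℂ (V →L[ℂ] V)} {H : Γ → (V →L[ℂ] V)} {h : Γ → ℝ}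
  {A : J → (V →L[ℂ] V)} {b : J → Γ → ℕ} {b' : Γ → Γ → ℕ}

lemma sum_prod_mul_norm_expansionCoeff_le (hs : SquareCondition H h)
    (hc : CommutationCondition 𝒜 H A b b') (hl : LocalityCondition 𝒜 H A b k aloc aac)
    (hy : y ^ 2 * localEnergy 𝒜 H h ^ 2 * aloc * k ≤ θ) (hθ : 0 ≤ θ) :
    ∑ U : Finset Γ with U.card ≤ 5, (∏ α ∈ U, h α) * |y| ^ U.card * ‖expansionCoeff H A y U‖ ≤
      growthFactor 1 θ * growthFactor 3 θ *
        (|y| * aloc ^ 2 * (k : ℝ) ^ 2 * globalEnergy h ^ 2) := by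
  rcases isEmpty_or_nonempty J with hJ | hJ
  · have h_zero (U : Finset Γ) : expansionCoeff H A y U = 0 := by
      simp [expansionCoeff, lindbladianCoeff]
    simp only [h_zero, norm_zero, mul_zero, Finset.sum_const_zero, growthFactor]
    positivity
  have h_mass (U : Finset Γ) : (∏ α ∈ U, h α) * |y| ^ U.card = ∏ α ∈ U, h α * |y| := by
    rw [Finset.prod_mul_distrib, Finset.prod_const]
  have h_glob : globalEnergy h ^ 2 = ∑ γ, h γ ^ 2 :=
    Real.sq_sqrt (Finset.sum_nonneg fun γ _ => sq_nonneg (h γ))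
  have hM : 0 ≤ aloc * k := mul_nonneg (zero_le_one.trans hl.one_le_aloc) k.cast_nonneg
  simp only [h_mass, h_glob]
  calc _ ≤ ∑ x : ExpansionIndex Γ, (∏ α ∈ survivingSigns x.labels, h α * |y|) *
        ‖expansionTerm H A y x‖ := sum_prod_mul_norm_expansionCoeff_le_sum hs.nonneg
    _ ≤ growthFactor 1 θ * growthFactor 3 θ * (aloc * k) ^ 2 * (|y| * ∑ γ, h γ ^ 2) :=
        sum_prod_mul_norm_expansionTerm_le hs hc (hl.interactionBounds hc hy) hM hθ
    _ = _ := by ring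

end Main

end LocalHamiltonian

open LocalHamiltonian in
theorem mainTheorem5_general {V : Type} [NormedAddCommGroup V] [InnerProductSpace ℂ V]
    [CompleteSpace V] {Γ J : Type} [Fintype Γ] [DecidableEq Γ] [Fintype J] {n k : ℕ}
    {aloc aac y θ : ℝ} {𝒜 : Fin n → Subalgebra ℂ (V →L[ℂ] V)} {H : Γ → (V →L[ℂ] V)} {h : Γ → ℝ}
    {A : J → (V →L[ℂ] V)} {b : J → Γ → ℕ} {b' : Γ → Γ → ℕ} (hs : SquareCondition H h)
    (hc : CommutationCondition 𝒜 H A b b') (hl : LocalityCondition 𝒜 H A b k aloc aac)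
    (hy : y ^ 2 * localEnergy 𝒜 H h ^ 2 * aloc * k ≤ θ) (hθ : 0 ≤ θ) :
    (∀ s : Γ → ℤˣ,
      lindbladian H A y s (lindbladian H A y s (hamiltonian H s)) =
        ∑ U : Finset Γ with U.card ≤ 5, (∏ α ∈ U, s α) • expansionCoeff H A y U) ∧
    ∑ U : Finset Γ with U.card ≤ 5, (∏ α ∈ U, h α) * |y| ^ U.card * ‖expansionCoeff H A y U‖ ≤
      growthFactor 1 θ * growthFactor 3 θ *
        (|y| * aloc ^ 2 * (k : ℝ) ^ 2 * globalEnergy h ^ 2) :=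
  ⟨fun s => lindbladian_lindbladian_hamiltonian H A y s,
    sum_prod_mul_norm_expansionCoeff_le hs hc hl hy hθ⟩

theorem mainTheorem5 :
    ∃ C : ℝ, ∀ (V : Type) [NormedAddCommGroup V] [InnerProductSpace ℂ V]
      [FiniteDimensional ℂ V] [CompleteSpace V]
      (Γ J : Type) [Fintype Γ] [DecidableEq Γ] [Fintype J]
      (n k : ℕ) (aloc aac y : ℝ)
      (𝒜 : Fin n → Subalgebra ℂ (V →L[ℂ] V))
      (H : Γ → (V →L[ℂ] V)) (h : Γ → ℝ) (A : J → (V →L[ℂ] V))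
      (b : J → Γ → ℕ) (b' : Γ → Γ → ℕ),
      LocalHamiltonian.SquareCondition H h →
      LocalHamiltonian.CommutationCondition 𝒜 H A b b' →
      LocalHamiltonian.LocalityCondition 𝒜 H A b k aloc aac →
      y ^ 2 * LocalHamiltonian.localEnergy 𝒜 H h ^ 2 * aloc * k < 1 / 8 →
      (∀ s : Γ → ℤˣ,
        LocalHamiltonian.lindbladian H A y s
            (LocalHamiltonian.lindbladian H A y s (LocalHamiltonian.hamiltonian H s)) =
          ∑ U : Finset Γ with U.card ≤ 5,
            (∏ α ∈ U, s α) • LocalHamiltonian.expansionCoeff H A y U) ∧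
      ∑ U : Finset Γ with U.card ≤ 5,
          (∏ α ∈ U, h α) * |y| ^ U.card * ‖LocalHamiltonian.expansionCoeff H A y U‖ ≤
        C * (|y| * aloc ^ 2 * (k : ℝ) ^ 2 * LocalHamiltonian.globalEnergy h ^ 2) :=
  ⟨_, fun _ _ _ _ _ _ _ _ _ _ _ _ _ _ _ _ _ _ _ _ _ hs hc hl hy =>
    mainTheorem5_general hs hc hl hy.le (by norm_num)⟩
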